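/- Let $d\ge 9$ and $n\ge 1$ be integers and let $\sigma,\lambda>0$ satisfy $\lambda/\sigma\le 0.2$. For $\theta=(\mu_1,\mu_2)\in\mathbb{R}^d\times\mathbb{R}^d$ let $P_\theta=\frac12\mathcal N(\mu_1,\sigma^2 I)+\frac12\mathcal N(\mu_2,\sigma^2 I)$, let $F_\theta(x)=\operatorname{argmax}_{i\in\{1,2\}}f(x;\mu_i,\sigma^2 I)$, where $f(\cdot\,;\mu,\Sigma)$ is the density of $\mathcal N(\mu,\Sigma)$ (ties, which form a null set when $\mu_1\ne\mu_2$, are given the label $1$), and for $F:\mathbb{R}^d\to\{1,2\}$ let $L_\theta(F)=\min_\pi P_\theta(\{x:F_\theta(x)\ne\pi(F(x))\})$, the minimum being over the permutations $\pi$ of $\{1,2\}$. Let $\Theta_\lambda=\{(\mu_1,\mu_2):\|\mu_1-\mu_2\|\ge\lambda\}$, with the Euclidean norm, and let $$R_n=\inf_{\widehat F_n}\sup_{\theta\in\Theta_\lambda}\mathbb{E}_\theta L_\theta(\widehat F_n),$$ where the infimum is over all estimators, that is, all rules assigning to data $X_1,\dots,X_n$ an assignment function $\widehat F_n=\widehat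 F_n(X_1,\dots,X_n;\cdot):\mathbb{R}^d\to\{1,2\}$, jointly measurable in the data and the point, and $\mathbb{E}_\theta$ is the expectation for $X_1,\dots,X_n$ i.i.d. with law $P_\theta$. Then $$R_n\ \ge\ \frac1{500}\min\left\{\frac{\sqrt{\log 2}}{3}\,\frac{\sigma^2}{\lambda^2}\sqrt{\frac{d-1}{n}},\ \frac14\right\}.$$ Hence $n\gtrsim d\,\sigma^4/\lambda^4$ samples are necessary for any constant target value of $R_n$ below $1/2000$: if $R_n\le r$ for some $0<r<\frac1{2000}$, then $$n\ \ge\ \frac{\log 2}{9\,(500\,r)^2}\,(d-1)\,\frac{\sigma^4}{\lambda^4}.$$ -/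

import Mathlib

open MeasureTheory
open scoped ENNReal

namespace GaussianClustering

noncomputable section

/-- The density at `x` of the isotropic Gaussian `N(m, σ² I)` on `ℝᵈ`. -/
def gaussDensity {d : ℕ} (σ : ℝ) (m x : EuclideanSpace ℝ (Fin d)) : ℝ :=
  (√(2 * Real.pi * σ ^ 2) ^ d)⁻¹ * Real.exp (-(‖x - m‖ ^ 2 / (2 * σ ^ 2)))

/-- The density of the equal-weight mixture of `N(θ.1, σ² I)` and `N(θ.2, σ² I)`. -/
def mixDensity {d : ℕ} (σ : ℝ) (θ : EuclideanSpace ℝ (Fin d) × EuclideanSpace ℝ (Fin d))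
    (x : EuclideanSpace ℝ (Fin d)) : ℝ :=
  1 / 2 * gaussDensity σ θ.1 x + 1 / 2 * gaussDensity σ θ.2 x

/-- The mixture distribution `P_θ`, the measure on `ℝᵈ` with density `mixDensity σ θ`. -/
def mixMeasure {d : ℕ} (σ : ℝ) (θ : EuclideanSpace ℝ (Fin d) × EuclideanSpace ℝ (Fin d)) :
    Measure (EuclideanSpace ℝ (Fin d)) :=
  volume.withDensity fun x => ENNReal.ofReal (mixDensity σ θ x)

/-- The parameter class `Θ_lam`: pairs of means at Euclidean distance at least `lam`. -/
def meanPairs (d : ℕ) (lam : ℝ) :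
    Set (EuclideanSpace ℝ (Fin d) × EuclideanSpace ℝ (Fin d)) :=
  {θ | lam ≤ ‖θ.1 - θ.2‖}

/-- The Bayes optimal assignment `F_θ`: the index of the component of larger density at `x`.
The labels 1, 2 are the elements `0`, `1` of `Fin 2`; a tie (which has probability zero as soon as
the two means differ) gets the first label. -/
def bayesAssign {d : ℕ} (σ : ℝ) (θ : EuclideanSpace ℝ (Fin d) × EuclideanSpace ℝ (Fin d))
    (x : EuclideanSpace ℝ (Fin d)) : Fin 2 :=
  open Classical in if gaussDensity σ θ.2 x ≤ gaussDensity σ θ.1 x then 0 else 1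

/-- The clustering loss `L_θ(F)`, the least over the relabelings `π` of the probability under `P_θ`
that `F_θ` and `π ∘ F` differ. -/
def clusterLoss {d : ℕ} (σ : ℝ) (θ : EuclideanSpace ℝ (Fin d) × EuclideanSpace ℝ (Fin d))
    (F : EuclideanSpace ℝ (Fin d) → Fin 2) : ℝ≥0∞ :=
  ⨅ π : Equiv.Perm (Fin 2), mixMeasure σ θ {x | bayesAssign σ θ x ≠ π (F x)}

/-- An estimator: it turns `n` data points into an assignment function on `ℝᵈ`, measurably in the
data and the point to be assigned together. -/
structure Estimator (d n : ℕ) where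
  /-- the assignment function learned from the data -/
  assign : (Fin n → EuclideanSpace ℝ (Fin d)) → EuclideanSpace ℝ (Fin d) → Fin 2
  measurable_assign : Measurable fun p :
    (Fin n → EuclideanSpace ℝ (Fin d)) × EuclideanSpace ℝ (Fin d) => assign p.1 p.2

/-- The expected loss `E_θ L_θ(F̂)`, the data being `n` independent draws from `P_θ`. -/
def expectedLoss {d n : ℕ} (σ : ℝ) (θ : EuclideanSpace ℝ (Fin d) × EuclideanSpace ℝ (Fin d))
    (Fhat : Estimator d n) : ℝ≥0∞ :=
  ∫⁻ X, clusterLoss σ θ (Fhat.assign X) ∂(Measure.pi fun _ : Fin n => mixMeasure σ θ)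

/-- The minimax expected clustering loss over `Θ_lam`. -/
def minimaxLoss (d n : ℕ) (σ lam : ℝ) : ℝ≥0∞ :=
  ⨅ Fhat : Estimator d n, ⨆ θ ∈ meanPairs d lam, expectedLoss σ θ Fhat

end

end GaussianClustering

namespace GaussianClustering

variable {d : ℕ} {σ : ℝ}

/-! Assouad's method on symmetric mixtures. The parameters are `(m, -m)` with `‖m‖ = lam / 2`, where
`m = cubeMean h s v` leans away from a fixed axis by an angle with sine `s`, in a direction given by
a vertex `v` of a cube of dimension `k = d - 1`.

Neighboring vertices are hard to tell apart. Relative to `N(0, σ² I)`, the `χ²` inner product of two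
symmetric mixtures is `cosh (⟪m, m'⟫ / σ²)`, because the terms odd in the means cancel. With `y =
‖m‖² / σ²`, flipping one coordinate therefore costs Hellinger affinity of order `y² s² / k`
(`affinity_symMix_ge`, `cosh_sub_cosh_le`); the square on `y` is the source of `σ⁴ / lam⁴`. With `n
y² s² ≤ k / 4`, the laws of `n` draws still overlap by `1 / 4` (`lintegral_min_prod_ge`).

The losses separate. Bayes assignments are halfspaces, which under any relabeling differ on Gaussian
mass proportional to the distance of their normals (`centeredGauss_bayesAssign_ne_ge`). Since each
mixture dominates a multiple of `N(0, σ² I)`, losses can be measured by this common law, where a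
triangle inequality holds (`gaussLoss_add_ge`). `assouad` combines the two facts, and `s` is then
taken as large as the overlap allows. -/

/-! ### Isotropic Gaussian densities. -/

lemma gaussDensity_pos (hσ : 0 < σ) (m x : EuclideanSpace ℝ (Fin d)) : 0 < gaussDensity σ m x := by
  unfold gaussDensity
  positivity

@[fun_prop]
lemma continuous_gaussDensity (m : EuclideanSpace ℝ (Fin d)) : Continuous (gaussDensity σ m) := by
  unfold gaussDensity
  fun_prop

lemma integrable_gaussDensity_and_integral (hσ : 0 < σ) (m : EuclideanSpace ℝ (Fin d)) :
    Integrable (gaussDensity σ m) ∧ ∫ x, gaussDensity σ m x = 1 := by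
  have hb : 0 < 1 / (2 * σ ^ 2) := by positivity
  have key : ∫ x : EuclideanSpace ℝ (Fin d), gaussDensity σ m x = 1 := by
    have h0 : ∀ x : EuclideanSpace ℝ (Fin d), gaussDensity σ m x = (√(2 * Real.pi * σ ^ 2) ^ d)⁻¹ *
        (fun y : EuclideanSpace ℝ (Fin d) => Real.exp (-(1 / (2 * σ ^ 2)) * ‖y‖ ^ 2)) (x - m) := by
      intro x
      simp only [gaussDensity]
      congr 2
      ring
    simp_rw [h0]
    rw [integral_const_mul, integral_sub_right_eq_self
      (fun y : EuclideanSpace ℝ (Fin d) => Real.exp (-(1 / (2 * σ ^ 2)) * ‖y‖ ^ 2)) m,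
      GaussianFourier.integral_rexp_neg_mul_sq_norm hb]
    have h1 : Real.pi / (1 / (2 * σ ^ 2)) = 2 * Real.pi * σ ^ 2 := by field_simp
    rw [h1, finrank_euclideanSpace_fin, Real.sqrt_eq_rpow, ← Real.rpow_natCast,
      ← Real.rpow_mul (by positivity)]
    have : (1 / 2 * (d : ℝ)) = d / 2 := by ring
    rw [this]
    exact inv_mul_cancel₀ (by positivity)
  refine ⟨?_, key⟩
  -- A nonintegrable function has integral `0` by convention, so the value `1` forces integrability.
  by_contra h
  rw [integral_undef h] at key
  exact zero_ne_one key

lemma integrable_gaussDensity (hσ : 0 < σ) (m : EuclideanSpace ℝ (Fin d)) :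
    Integrable (gaussDensity σ m) :=
  (integrable_gaussDensity_and_integral hσ m).1

lemma integral_gaussDensity (hσ : 0 < σ) (m : EuclideanSpace ℝ (Fin d)) :
    ∫ x, gaussDensity σ m x = 1 :=
  (integrable_gaussDensity_and_integral hσ m).2

lemma gaussDensity_eq_zero_mul (hσ : 0 < σ) (m x : EuclideanSpace ℝ (Fin d)) :
    gaussDensity σ m x = gaussDensity σ 0 x *
      Real.exp (inner ℝ x m / σ ^ 2 - ‖m‖ ^ 2 / (2 * σ ^ 2)) := by
  unfold gaussDensity
  rw [mul_assoc _ (Real.exp _), ← Real.exp_add]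
  congr 2
  rw [norm_sub_sq_real, sub_zero]
  field_simp
  ring

/-- Both factors are exponential tilts of the centered density. Tilts multiply, and completing the
square leaves only the cross term of `‖m + m'‖²`. -/
lemma gaussDensity_mul_div (hσ : 0 < σ) (m m' x : EuclideanSpace ℝ (Fin d)) :
    gaussDensity σ m x * gaussDensity σ m' x / gaussDensity σ 0 x =
      Real.exp (inner ℝ m m' / σ ^ 2) * gaussDensity σ (m + m') x := by
  have h0 := (gaussDensity_pos hσ 0 x).ne'
  rw [gaussDensity_eq_zero_mul hσ m, gaussDensity_eq_zero_mul hσ m',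
    gaussDensity_eq_zero_mul hσ (m + m')]
  have : Real.exp (inner ℝ x m / σ ^ 2 - ‖m‖ ^ 2 / (2 * σ ^ 2)) *
      Real.exp (inner ℝ x m' / σ ^ 2 - ‖m'‖ ^ 2 / (2 * σ ^ 2)) =
      Real.exp (inner ℝ m m' / σ ^ 2) *
      Real.exp (inner ℝ x (m + m') / σ ^ 2 - ‖m + m'‖ ^ 2 / (2 * σ ^ 2)) := by
    rw [← Real.exp_add, ← Real.exp_add, norm_add_sq_real, inner_add_right]
    congr 1
    field_simp
    ring
  rw [div_eq_iff h0]
  linear_combination (gaussDensity σ 0 x) ^ 2 * this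

/-! ### Symmetric mixtures and their Hellinger affinity. -/

/-- The mixture of `N(m, σ² I)` and `N(-m, σ² I)`. -/
noncomputable def symMix (σ : ℝ) (m : EuclideanSpace ℝ (Fin d)) : EuclideanSpace ℝ (Fin d) → ℝ :=
  mixDensity σ (m, -m)

lemma symMix_apply (m x : EuclideanSpace ℝ (Fin d)) :
    symMix σ m x = 1 / 2 * gaussDensity σ m x + 1 / 2 * gaussDensity σ (-m) x := rfl

lemma symMix_pos (hσ : 0 < σ) (m x : EuclideanSpace ℝ (Fin d)) : 0 < symMix σ m x := by
  have h1 := gaussDensity_pos hσ m x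
  have h2 := gaussDensity_pos hσ (-m) x
  rw [symMix_apply]
  positivity

@[fun_prop]
lemma continuous_symMix (m : EuclideanSpace ℝ (Fin d)) : Continuous (symMix σ m) := by
  have : symMix σ m = fun x => 1 / 2 * gaussDensity σ m x + 1 / 2 * gaussDensity σ (-m) x := rfl
  rw [this]
  fun_prop

lemma integrable_symMix (hσ : 0 < σ) (m : EuclideanSpace ℝ (Fin d)) : Integrable (symMix σ m) :=
  ((integrable_gaussDensity hσ m).const_mul _).add ((integrable_gaussDensity hσ (-m)).const_mul _)

lemma integral_symMix (hσ : 0 < σ) (m : EuclideanSpace ℝ (Fin d)) : ∫ x, symMix σ m x = 1 := by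
  simp_rw [symMix_apply]
  rw [integral_add ((integrable_gaussDensity hσ m).const_mul _)
    ((integrable_gaussDensity hσ (-m)).const_mul _), integral_const_mul, integral_const_mul,
    integral_gaussDensity hσ, integral_gaussDensity hσ]
  norm_num

/-- The tilts by `m` and `-m` average to a hyperbolic cosine, which is at least `1`. This bounds the
denominators in the affinity estimate and later moves losses to the centered Gaussian. -/
lemma symMix_ge (hσ : 0 < σ) (m x : EuclideanSpace ℝ (Fin d)) :
    Real.exp (-(‖m‖ ^ 2 / (2 * σ ^ 2))) * gaussDensity σ 0 x ≤ symMix σ m x := by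
  have h0 := gaussDensity_pos hσ 0 x
  rw [symMix_apply, gaussDensity_eq_zero_mul hσ m, gaussDensity_eq_zero_mul hσ (-m),
    inner_neg_right,
    norm_neg, sub_eq_add_neg, Real.exp_add, sub_eq_add_neg, Real.exp_add]
  have h1 := Real.one_le_cosh (inner ℝ x m / σ ^ 2)
  rw [Real.cosh_eq] at h1
  rw [neg_div]
  have h2 := Real.exp_pos (-(‖m‖ ^ 2 / (2 * σ ^ 2)))
  linarith [mul_le_mul_of_nonneg_left h1 (mul_pos h0 h2).le]

lemma integral_symMix_mul_div (hσ : 0 < σ) (m m' : EuclideanSpace ℝ (Fin d)) :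
    Integrable (fun x => symMix σ m x * symMix σ m' x / gaussDensity σ 0 x) ∧
    ∫ x, symMix σ m x * symMix σ m' x / gaussDensity σ 0 x =
      Real.cosh (inner ℝ m m' / σ ^ 2) := by
  have h : (fun x => symMix σ m x * symMix σ m' x / gaussDensity σ 0 x) = fun x =>
      1 / 4 * Real.exp (inner ℝ m m' / σ ^ 2) *
        (gaussDensity σ (m + m') x + gaussDensity σ (-m + -m') x) +
      1 / 4 * Real.exp (-(inner ℝ m m' / σ ^ 2)) *
        (gaussDensity σ (m + -m') x + gaussDensity σ (-m + m') x) := by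
    funext x
    have a1 := gaussDensity_mul_div hσ m m' x
    have a2 := gaussDensity_mul_div hσ (-m) (-m') x
    have a3 := gaussDensity_mul_div hσ m (-m') x
    have a4 := gaussDensity_mul_div hσ (-m) m' x
    simp only [inner_neg_left, inner_neg_right, neg_neg, neg_div] at a1 a2 a3 a4
    rw [symMix_apply, symMix_apply]
    linear_combination (1 / 4) * (a1 + a2 + a3 + a4)
  have I := fun m => integrable_gaussDensity (d := d) hσ m
  have i1 := ((I (m + m')).add (I (-m + -m'))).const_mul
    (1 / 4 * Real.exp (inner ℝ m m' / σ ^ 2))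
  have i2 := ((I (m + -m')).add (I (-m + m'))).const_mul
    (1 / 4 * Real.exp (-(inner ℝ m m' / σ ^ 2)))
  rw [h]
  refine ⟨i1.add i2, ?_⟩
  have := integral_add i1 i2
  simp only [Pi.add_apply] at this
  rw [this, integral_const_mul, integral_const_mul, integral_add (I _) (I _),
    integral_add (I _) (I _)]
  simp only [integral_gaussDensity hσ]
  rw [Real.cosh_eq]
  ring

/-- The gap between the two means is `(√p - √q)² / 2 = (p - q)² / (2 (√p + √q)²)`, and `√p + √q ≥ 2
√c`. -/
lemma sqrt_mul_ge_half_add_sub {p q c : ℝ} (hc : 0 < c) (hp : c ≤ p) (hq : c ≤ q) :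
    (p + q) / 2 - (p - q) ^ 2 / (8 * c) ≤ √(p * q) := by
  have hp0 := hc.le.trans hp
  have hq0 := hc.le.trans hq
  rw [Real.sqrt_mul hp0]
  obtain ⟨a, ha⟩ : ∃ a, a = √p := ⟨_, rfl⟩
  obtain ⟨b, hb⟩ : ∃ b, b = √q := ⟨_, rfl⟩
  obtain ⟨e, he⟩ : ∃ e, e = √c := ⟨_, rfl⟩
  have h1 : p = a ^ 2 := by rw [ha, Real.sq_sqrt hp0]
  have h2 : q = b ^ 2 := by rw [hb, Real.sq_sqrt hq0]
  have h3 : c = e ^ 2 := by rw [he, Real.sq_sqrt hc.le]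
  have he0 : 0 < e := he ▸ Real.sqrt_pos.2 hc
  have hae : e ≤ a := by rw [he, ha]; exact Real.sqrt_le_sqrt hp
  have hbe : e ≤ b := by rw [he, hb]; exact Real.sqrt_le_sqrt hq
  rw [← ha, ← hb, h1, h2]
  have : (a - b) ^ 2 / 2 ≤ (a ^ 2 - b ^ 2) ^ 2 / (8 * c) := by
    rw [div_le_div_iff₀ (by norm_num) (by positivity), h3]
    have : (2 * e) ^ 2 ≤ (a + b) ^ 2 := by gcongr; linarith
    nlinarith [mul_le_mul_of_nonneg_left this (sq_nonneg (a - b))]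
  nlinarith

/-- The Hellinger affinity of two symmetric mixtures whose means have the same length. -/
lemma affinity_symMix_ge (hσ : 0 < σ) {m m' : EuclideanSpace ℝ (Fin d)} (hm : ‖m‖ = ‖m'‖) :
    1 - Real.exp (‖m‖ ^ 2 / (2 * σ ^ 2)) / 4 *
        (Real.cosh (‖m‖ ^ 2 / σ ^ 2) - Real.cosh (inner ℝ m m' / σ ^ 2)) ≤
      ∫ x, √(symMix σ m x * symMix σ m' x) := by
  obtain ⟨i1, e1⟩ := integral_symMix_mul_div hσ m m
  obtain ⟨i2, e2⟩ := integral_symMix_mul_div hσ m' m'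
  obtain ⟨i3, e3⟩ := integral_symMix_mul_div hσ m m'
  set K := Real.exp (‖m‖ ^ 2 / (2 * σ ^ 2)) with hK
  have j1 := ((integrable_symMix hσ m).add (integrable_symMix hσ m')).const_mul (1 / 2)
  have j2 := ((i1.add i2).sub (i3.const_mul 2)).const_mul (K / 8)
  -- Here `c` is the lower bound of `symMix_ge`, common to both mixtures because the norms agree;
  -- expanding `(p - q)²` leaves three integrals, each a `cosh`.
  have hle : ∀ x, (1 / 2) * (symMix σ m + symMix σ m') x -
      K / 8 * (symMix σ m x * symMix σ m x / gaussDensity σ 0 x +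
        symMix σ m' x * symMix σ m' x / gaussDensity σ 0 x -
        2 * (symMix σ m x * symMix σ m' x / gaussDensity σ 0 x)) ≤
      √(symMix σ m x * symMix σ m' x) := by
    intro x
    have h0 := gaussDensity_pos hσ 0 x
    have hq := symMix_ge hσ m' x
    rw [← hm] at hq
    refine le_trans (le_of_eq ?_) (sqrt_mul_ge_half_add_sub (mul_pos (Real.exp_pos _) h0)
      (symMix_ge hσ m x) hq)
    rw [Real.exp_neg, ← hK, Pi.add_apply]
    have hK0 : K ≠ 0 := (Real.exp_pos _).ne'
    field_simp
    ring
  have i4 : Integrable fun x => √(symMix σ m x * symMix σ m' x) := by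
    refine ((integrable_symMix hσ m).add (integrable_symMix hσ m')).mono'
      (by fun_prop) (Filter.Eventually.of_forall fun x => ?_)
    have p1 := symMix_pos hσ m x
    have p2 := symMix_pos hσ m' x
    rw [Real.norm_of_nonneg (Real.sqrt_nonneg _), Pi.add_apply, Real.sqrt_le_left (by positivity)]
    nlinarith
  refine le_trans (le_of_eq ?_) (integral_mono (j1.sub j2) i4 hle)
  have s1 := integral_sub j1 j2
  have s2 := integral_sub (i1.add i2) (i3.const_mul 2)
  have s3 := integral_add i1 i2
  have s4 := integral_add (integrable_symMix hσ m) (integrable_symMix hσ m')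
  simp only [Pi.add_apply, Pi.sub_apply] at s1 s2 s3 s4 ⊢
  rw [s1, integral_const_mul, integral_const_mul, s2, s3, s4, integral_const_mul, e1, e2, e3,
    integral_symMix hσ, integral_symMix hσ, real_inner_self_eq_norm_sq,
    real_inner_self_eq_norm_sq, ← hm]
  ring

/-! ### Product densities and orthonormal coordinates of a Gaussian vector. -/

lemma lintegral_pi_ofReal_prod {ι α : Type*} [Fintype ι] [MeasurableSpace α] {ν : ι → Measure α}
    [∀ i, SigmaFinite (ν i)] {f : ι → α → ℝ} (hf : ∀ i x, 0 ≤ f i x)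
    (hi : ∀ i, Integrable (f i) (ν i)) :
    ∫⁻ x, ENNReal.ofReal (∏ i, f i (x i)) ∂(Measure.pi ν) =
      ∏ i, ∫⁻ x, ENNReal.ofReal (f i x) ∂(ν i) := by
  rw [← ofReal_integral_eq_lintegral_ofReal (Integrable.fintype_prod_dep hi)
    (Filter.Eventually.of_forall fun x => Finset.prod_nonneg fun i _ => hf i (x i)),
    integral_fintype_prod_eq_prod,
    ENNReal.ofReal_prod_of_nonneg fun i _ => integral_nonneg (hf i)]
  exact Finset.prod_congr rfl fun i _ =>
    ofReal_integral_eq_lintegral_ofReal (hi i) (Filter.Eventually.of_forall (hf i))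

lemma pi_withDensity_ofReal {ι α : Type*} [Fintype ι] [MeasurableSpace α] {ν : ι → Measure α}
    [∀ i, SigmaFinite (ν i)] {f : ι → α → ℝ} (hf : ∀ i x, 0 ≤ f i x)
    (hi : ∀ i, Integrable (f i) (ν i)) :
    Measure.pi (fun i => (ν i).withDensity fun x => ENNReal.ofReal (f i x)) =
      (Measure.pi ν).withDensity fun x => ENNReal.ofReal (∏ i, f i (x i)) := by
  have := fun i => isFiniteMeasure_withDensity_ofReal (hi i).2
  refine (Measure.pi_eq fun s hs => ?_)
  rw [withDensity_apply _ (MeasurableSet.univ_pi hs), Measure.restrict_pi_pi,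
    lintegral_pi_ofReal_prod hf fun i => (hi i).mono_measure Measure.restrict_le_self]
  exact Finset.prod_congr rfl fun i _ => (withDensity_apply _ (hs i)).symm

/-- The isotropic centered Gaussian measure `N(0, σ² I)`. -/
noncomputable def centeredGauss (d : ℕ) (σ : ℝ) : Measure (EuclideanSpace ℝ (Fin d)) :=
  volume.withDensity fun x => ENNReal.ofReal (gaussDensity σ 0 x)

instance : SFinite (centeredGauss d σ) := by
  unfold centeredGauss
  infer_instance

lemma gaussDensity_zero_eq_prod {ι : Type*} [Fintype ι]
    (b : OrthonormalBasis ι ℝ (EuclideanSpace ℝ (Fin d))) (x : EuclideanSpace ℝ (Fin d)) :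
    gaussDensity σ 0 x =
      ∏ i, ProbabilityTheory.gaussianPDFReal 0 (σ ^ 2).toNNReal ((b.repr x).ofLp i) := by
  have hc : d = Fintype.card ι := by
    rw [← Module.finrank_eq_card_basis b.toBasis, finrank_euclideanSpace_fin]
  simp only [gaussDensity, ProbabilityTheory.gaussianPDFReal, Real.coe_toNNReal _ (sq_nonneg σ),
    sub_zero]
  rw [Finset.prod_mul_distrib, Finset.prod_const, Finset.card_univ, ← hc, inv_pow, ← Real.exp_sum]
  congr 2
  rw [← b.repr.norm_map x, EuclideanSpace.real_norm_sq_eq, ← Finset.sum_div, Finset.sum_neg_distrib,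
    neg_div]

lemma measurePreserving_coords_centeredGauss (hσ : 0 < σ) {ι : Type*} [Fintype ι]
    (b : OrthonormalBasis ι ℝ (EuclideanSpace ℝ (Fin d))) :
    MeasurePreserving (fun x => (b.repr x).ofLp) (centeredGauss d σ)
      (Measure.pi fun _ : ι => ProbabilityTheory.gaussianReal 0 (σ ^ 2).toNNReal) := by
  have hv : (σ ^ 2).toNNReal ≠ 0 := (Real.toNNReal_pos.2 (by positivity)).ne'
  have he : MeasurePreserving (fun x => (b.repr x).ofLp)
      (volume : Measure (EuclideanSpace ℝ (Fin d)))
      (volume : Measure (ι → ℝ)) :=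
    (PiLp.volume_preserving_ofLp ι).comp b.measurePreserving_repr
  refine ⟨he.measurable, ?_⟩
  simp_rw [ProbabilityTheory.gaussianReal_of_var_ne_zero 0 hv]
  have hpi := pi_withDensity_ofReal (ν := fun _ : ι => (volume : Measure ℝ))
    (fun _ x => ProbabilityTheory.gaussianPDFReal_nonneg 0 (σ ^ 2).toNNReal x)
    (fun _ => ProbabilityTheory.integrable_gaussianPDFReal 0 (σ ^ 2).toNNReal)
  refine Eq.trans ?_ hpi.symm
  ext s hs
  rw [Measure.map_apply he.measurable hs, centeredGauss, withDensity_apply _ (he.measurable hs),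
    withDensity_apply _ hs]
  simp_rw [gaussDensity_zero_eq_prod b]
  refine he.setLIntegral_comp_preimage hs (f := fun y => ENNReal.ofReal
    (∏ i, ProbabilityTheory.gaussianPDFReal 0 (σ ^ 2).toNNReal (y i))) ?_
  refine ENNReal.measurable_ofReal.comp (Finset.measurable_prod _ fun i _ => ?_)
  exact (ProbabilityTheory.measurable_gaussianPDFReal _ _).comp (measurable_pi_apply i)

/-- Orthogonal coordinates of a centered isotropic Gaussian vector are independent. -/
lemma centeredGauss_inner_mem_and (hσ : 0 < σ) {a b : EuclideanSpace ℝ (Fin d)}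
    (hab : Orthonormal ℝ ![a, b]) {s t : Set ℝ} (hs : MeasurableSet s) (ht : MeasurableSet t) :
    centeredGauss d σ {x | inner ℝ a x ∈ s ∧ inner ℝ b x ∈ t} =
      ProbabilityTheory.gaussianReal 0 (σ ^ 2).toNNReal s *
        ProbabilityTheory.gaussianReal 0 (σ ^ 2).toNNReal t := by
  classical
  obtain ⟨u, B, hu, hB⟩ := hab.toSubtypeRange.exists_orthonormalBasis_extension
  obtain ⟨i, hi⟩ : ∃ i : u, B i = a := ⟨⟨a, hu ⟨0, rfl⟩⟩, by rw [hB]⟩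
  obtain ⟨j, hj⟩ : ∃ j : u, B j = b := ⟨⟨b, hu ⟨1, rfl⟩⟩, by rw [hB]⟩
  have hij : i ≠ j := by
    intro h
    have h1 : a = b := by rw [← hi, ← hj, h]
    exact zero_ne_one (hab.linearIndependent.injective (show ![a, b] 0 = ![a, b] 1 from h1))
  have hset : {x | inner ℝ a x ∈ s ∧ inner ℝ b x ∈ t} = (fun x => (B.repr x).ofLp) ⁻¹'
      (Set.pi Set.univ fun l => if l = i then s else if l = j then t else Set.univ) := by
    ext x
    simp only [Set.mem_ofPred_eq, Set.mem_preimage, Set.mem_pi, Set.mem_univ, true_implies,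
      B.repr_apply_apply]
    constructor
    · rintro ⟨h1, h2⟩ l
      split_ifs with hl hl'
      · rwa [hl, hi]
      · rwa [hl', hj]
      · trivial
    · intro h
      have h1 := h i
      have h2 := h j
      rw [if_pos rfl, hi] at h1
      rw [if_neg hij.symm, if_pos rfl, hj] at h2
      exact ⟨h1, h2⟩
  rw [hset, (measurePreserving_coords_centeredGauss hσ B).measure_preimage
    (MeasurableSet.univ_pi fun l => by split_ifs <;> simp [hs, ht]).nullMeasurableSet,
    Measure.pi_pi, ← Finset.mul_prod_erase _ _ (Finset.mem_univ i), if_pos rfl,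
    ← Finset.mul_prod_erase _ _ (Finset.mem_erase.2 ⟨hij.symm, Finset.mem_univ j⟩),
    if_neg hij.symm, if_pos rfl, Finset.prod_eq_one, mul_one]
  intro l hl
  simp only [Finset.mem_erase, Finset.mem_univ, and_true] at hl
  rw [if_neg hl.2, if_neg hl.1, measure_univ]

/-! ### Gaussian mass between two halfspaces. -/

lemma gaussianReal_ge_mul_volume (hσ : 0 < σ) {R : ℝ} {s : Set ℝ} (hs : MeasurableSet s)
    (hR : ∀ x ∈ s, x ^ 2 ≤ R * σ ^ 2) :
    ENNReal.ofReal ((√(2 * Real.pi) * σ)⁻¹ * Real.exp (-R / 2)) * volume s ≤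
      ProbabilityTheory.gaussianReal 0 (σ ^ 2).toNNReal s := by
  have hv : (σ ^ 2).toNNReal ≠ 0 := (Real.toNNReal_pos.2 (by positivity)).ne'
  rw [ProbabilityTheory.gaussianReal_apply _ hv, ← setLIntegral_const]
  refine setLIntegral_mono' hs fun x hx => ENNReal.ofReal_le_ofReal ?_
  rw [ProbabilityTheory.gaussianPDFReal, Real.coe_toNNReal _ (sq_nonneg σ),
    Real.sqrt_mul (show 0 ≤ 2 * Real.pi by positivity) (σ ^ 2), Real.sqrt_sq hσ.le, sub_zero]
  refine mul_le_mul_of_nonneg_left (Real.exp_le_exp.2 ?_) (by positivity)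
  rw [div_le_div_iff₀ (by norm_num) (by positivity)]
  nlinarith [hR x hx]

lemma exp_five_halves_mul_pi_le : Real.exp (5 / 2) * Real.pi ≤ 40 := by
  have h1 : Real.exp (5 / 2) ≤ 12.5 := by
    have h2 : Real.exp (5 / 2) ^ 2 = Real.exp 1 ^ 5 := by
      rw [← Real.exp_nat_mul, ← Real.exp_nat_mul]
      norm_num
    have h3 : Real.exp 1 ^ 5 ≤ 2.7182818286 ^ 5 := by
      gcongr
      exact Real.exp_one_lt_d9.le
    refine le_of_sq_le_sq ?_ (by norm_num)
    rw [h2]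
    exact h3.trans (by norm_num)
  nlinarith [Real.pi_lt_d2, Real.pi_pos, Real.exp_pos (5 / 2)]

/-- A strip of half-width `τ σ` around a hyperplane through the origin, cut far from it in an
orthogonal direction, has Gaussian measure of order `τ`. -/
lemma centeredGauss_strip_ge (hσ : 0 < σ) {a b : EuclideanSpace ℝ (Fin d)}
    (hab : Orthonormal ℝ ![a, b]) {τ : ℝ} (hτ0 : 0 ≤ τ) (hτ : τ ≤ 1) :
    ENNReal.ofReal (τ / 40) ≤ centeredGauss d σ
      {x | inner ℝ a x ∈ Set.Ioo (-(τ * σ)) (τ * σ) ∧ inner ℝ b x ∈ Set.Icc σ (2 * σ)} := by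
  rw [centeredGauss_inner_mem_and hσ hab measurableSet_Ioo measurableSet_Icc]
  have h1 := gaussianReal_ge_mul_volume hσ (R := 1) (s := Set.Ioo (-(τ * σ)) (τ * σ))
    measurableSet_Ioo fun x hx => by
      have : |x| ≤ 1 * σ := (abs_lt.2 hx).le.trans (by gcongr)
      rw [← sq_abs]
      nlinarith [abs_nonneg x]
  have h2 := gaussianReal_ge_mul_volume hσ (R := 4) (s := Set.Icc σ (2 * σ))
    measurableSet_Icc fun x hx => by nlinarith [hx.1, hx.2]
  refine le_trans ?_ (mul_le_mul' h1 h2)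
  rw [Real.volume_Ioo, Real.volume_Icc, ← ENNReal.ofReal_mul (by positivity),
    ← ENNReal.ofReal_mul (by positivity), ← ENNReal.ofReal_mul (by
      have : 0 ≤ τ * σ - -(τ * σ) := by nlinarith [mul_nonneg hτ0 hσ.le]
      positivity)]
  refine ENNReal.ofReal_le_ofReal ?_
  have hp : √(2 * Real.pi) ^ 2 = 2 * Real.pi := Real.sq_sqrt (by positivity)
  have e : Real.exp (-1 / 2) * Real.exp (-4 / 2) = (Real.exp (5 / 2))⁻¹ := by
    rw [← Real.exp_add, ← Real.exp_neg]
    norm_num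
  have : (√(2 * Real.pi) * σ)⁻¹ * Real.exp (-1 / 2) * (τ * σ - -(τ * σ)) *
      ((√(2 * Real.pi) * σ)⁻¹ * Real.exp (-4 / 2) * (2 * σ - σ)) =
      τ / (Real.exp (5 / 2) * Real.pi) := by
    calc _ = 2 * τ * (√(2 * Real.pi) ^ 2)⁻¹ * (Real.exp (-1 / 2) * Real.exp (-4 / 2)) := by
          field_simp
          ring
      _ = _ := by
          rw [hp, e]
          field_simp
  rw [this]
  exact div_le_div_of_nonneg_left hτ0 (by positivity) exp_five_halves_mul_pi_le

/-- The two means have the same norm, so the quadratic terms cancel in the comparison of densities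
and only the sign of the inner product is left. -/
lemma bayesAssign_symm_eq (hσ : 0 < σ) (m x : EuclideanSpace ℝ (Fin d)) :
    bayesAssign σ (m, -m) x = open Classical in if 0 ≤ inner ℝ x m then 0 else 1 := by
  unfold bayesAssign
  congr 1
  simp only [eq_iff_iff]
  rw [gaussDensity_eq_zero_mul hσ m, gaussDensity_eq_zero_mul hσ (-m),
    mul_le_mul_iff_right₀ (gaussDensity_pos hσ 0 x), Real.exp_le_exp, inner_neg_right, norm_neg,
    sub_le_sub_iff_right, div_le_div_iff_of_pos_right (by positivity)]
  constructor <;> intro h <;> linarith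

/-- Two halfspaces through the origin differ on a set of Gaussian measure proportional to the
distance of their normals. -/
lemma centeredGauss_bayesAssign_ne_ge (hσ : 0 < σ) {h : ℝ} (hh : 0 < h)
    {m m' : EuclideanSpace ℝ (Fin d)} (hm : ‖m‖ = h) (hm' : ‖m'‖ = h) (hin : 0 ≤ inner ℝ m m')
    (π : Equiv.Perm (Fin 2)) :
    ENNReal.ofReal (‖m - m'‖ / (2 * h) / 40) ≤
      centeredGauss d σ {x | bayesAssign σ (m, -m) x ≠ π (bayesAssign σ (m', -m') x)} := by
  rcases eq_or_ne m m' with rfl | hne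
  · simp
  obtain ⟨A, hA⟩ : ∃ A, A = ‖m + m'‖ / 2 := ⟨_, rfl⟩
  obtain ⟨B, hB⟩ : ∃ B, B = ‖m - m'‖ / 2 := ⟨_, rfl⟩
  have hB0 : 0 < B := by
    rw [hB]
    have := norm_pos_iff.2 (sub_ne_zero.2 hne)
    positivity
  have hBA : B ≤ A := by
    rw [hA, hB]
    refine div_le_div_of_nonneg_right (le_of_sq_le_sq ?_ (norm_nonneg _)) (by norm_num)
    rw [norm_add_sq_real, norm_sub_sq_real]
    linarith
  have hAh : A ≤ h := by
    have := norm_add_le m m'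
    rw [hA]
    linarith
  have hA0 : 0 < A := hB0.trans_le hBA
  obtain ⟨a, ha⟩ : ∃ a, a = (2 * A)⁻¹ • (m + m') := ⟨_, rfl⟩
  obtain ⟨b, hb⟩ : ∃ b, b = (2 * B)⁻¹ • (m - m') := ⟨_, rfl⟩
  have hmab : m = A • a + B • b := by
    rw [ha, hb, smul_smul, smul_smul, show A * (2 * A)⁻¹ = 1 / 2 by field_simp,
      show B * (2 * B)⁻¹ = 1 / 2 by field_simp]
    module
  have hmab' : m' = A • a - B • b := by
    rw [ha, hb, smul_smul, smul_smul, show A * (2 * A)⁻¹ = 1 / 2 by field_simp,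
      show B * (2 * B)⁻¹ = 1 / 2 by field_simp]
    module
  have na : ‖a‖ = 1 := by
    rw [ha, norm_smul, Real.norm_of_nonneg (by positivity), hA]
    have : ‖m + m'‖ ≠ 0 := by linarith
    field_simp
  have nb : ‖b‖ = 1 := by
    rw [hb, norm_smul, Real.norm_of_nonneg (by positivity), hB]
    have : ‖m - m'‖ ≠ 0 := by linarith
    field_simp
  have nab : inner ℝ a b = 0 := by
    rw [ha, hb, real_inner_smul_left, real_inner_smul_right, inner_add_left, inner_sub_right,
      inner_sub_right, real_inner_self_eq_norm_sq, real_inner_self_eq_norm_sq, hm, hm',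
      real_inner_comm m m']
    ring
  have hab : Orthonormal ℝ ![a, b] := by
    simp [orthonormal_vecCons_iff, na, nb, nab]
  have hba : Orthonormal ℝ ![b, a] := by
    simp [orthonormal_vecCons_iff, na, nb, nab, real_inner_comm]
  have hτ : ‖m - m'‖ / (2 * h) = B / h := by rw [hB]; field_simp
  have hτ0 : 0 ≤ B / h := by positivity
  have hτ1 : B / h ≤ 1 := (div_le_one hh).2 (hBA.trans hAh)
  have i1 : ∀ x, inner ℝ x m = A * inner ℝ a x + B * inner ℝ b x := fun x => by
    rw [hmab, inner_add_right, real_inner_smul_right, real_inner_smul_right, real_inner_comm a x,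
      real_inner_comm b x]
  have i2 : ∀ x, inner ℝ x m' = A * inner ℝ a x - B * inner ℝ b x := fun x => by
    rw [hmab', inner_sub_right, real_inner_smul_right, real_inner_smul_right, real_inner_comm a x,
      real_inner_comm b x]
  rw [hτ]
  have hAτ : A * (B / h * σ) ≤ B * σ := by
    calc A * (B / h * σ) = (A / h) * (B * σ) := by ring
      _ ≤ 1 * (B * σ) := by gcongr; exact (div_le_one hh).2 hAh
      _ = _ := one_mul _
  have hBτ : B * (B / h * σ) ≤ A * σ := by
    calc B * (B / h * σ) = (B / h) * (B * σ) := by ring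
      _ ≤ 1 * (A * σ) := by gcongr
      _ = _ := one_mul _
  -- For the identity, the strip is thin along `a`, so the `b` terms, of opposite signs, decide and
  -- the labels differ. For the swap, it is thin along `b`, so the common `a` term decides, the
  -- labels agree, and the swap breaks the agreement.
  rcases Fin.exists_fin_two.1 ⟨π 0, rfl⟩ with h0 | h0
  · have h1 : π 1 = 1 := by
      have : π 1 ≠ π 0 := fun h => one_ne_zero (π.injective h)
      omega
    refine (centeredGauss_strip_ge hσ hab hτ0 hτ1).trans (measure_mono ?_)
    rintro x ⟨⟨hs1, hs2⟩, ⟨ht1, ht2⟩⟩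
    have k1 := mul_lt_mul_of_pos_left hs1 hA0
    have k2 := mul_lt_mul_of_pos_left hs2 hA0
    have k3 := mul_le_mul_of_nonneg_left ht1 hB0.le
    have p1 : 0 ≤ inner ℝ x m := by rw [i1]; linarith
    have p2 : ¬ 0 ≤ inner ℝ x m' := by rw [i2]; linarith
    simp only [Set.mem_ofPred_eq, bayesAssign_symm_eq hσ, if_pos p1, if_neg p2, h1]
    decide
  · refine (centeredGauss_strip_ge hσ hba hτ0 hτ1).trans (measure_mono ?_)
    rintro x ⟨⟨hs1, hs2⟩, ⟨ht1, ht2⟩⟩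
    have k1 := mul_lt_mul_of_pos_left hs1 hB0
    have k2 := mul_lt_mul_of_pos_left hs2 hB0
    have k3 := mul_le_mul_of_nonneg_left ht1 hA0.le
    have p1 : 0 ≤ inner ℝ x m := by rw [i1]; linarith
    have p2 : 0 ≤ inner ℝ x m' := by rw [i2]; linarith
    simp only [Set.mem_ofPred_eq, bayesAssign_symm_eq hσ, if_pos p1, if_pos p2, h0]
    decide

/-! ### Assouad's lemma on the Boolean cube. -/

/-- The vertex of the cube `{false, true}ᵏ` adjacent to `v` across the `i`-th coordinate. -/
def flipAt {k : ℕ} (i : Fin k) (v : Fin k → Bool) : Fin k → Bool := Function.update v i (!v i)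

lemma flipAt_involutive {k : ℕ} (i : Fin k) : Function.Involutive (flipAt i) := by
  intro v
  simp [flipAt]

lemma hammingDist_flipAt {k : ℕ} (i : Fin k) (v : Fin k → Bool) :
    hammingDist v (flipAt i v) = 1 := by
  have h : ∀ j, v j ≠ flipAt i v j ↔ j = i := fun j => by
    by_cases hj : j = i
    · subst hj
      simp [flipAt]
    · simp [flipAt, hj]
  rw [hammingDist, Finset.card_eq_one]
  refine ⟨i, Finset.ext fun j => Finset.mem_filter.trans ?_⟩
  rw [h, Finset.mem_singleton]
  exact and_iff_right (Finset.mem_univ j)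

/-- Of `v` and its flip, exactly one disagrees with `w` at `i`, and its weight is at least the
minimum. Summing over all `v` counts each pair twice. -/
lemma sum_min_flipAt_le {k : ℕ} (P : (Fin k → Bool) → ℝ≥0∞) (w : Fin k → Bool) (i : Fin k) :
    ∑ v, min (P v) (P (flipAt i v)) ≤ 2 * ∑ v, (if v i ≠ w i then 1 else 0) * P v := by
  have h : ∑ v, (if v i ≠ w i then 1 else 0) * P v =
      ∑ v, (if flipAt i v i ≠ w i then 1 else 0) * P (flipAt i v) :=
    (Equiv.sum_comp (flipAt_involutive i).toPerm fun v =>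
      (if v i ≠ w i then 1 else 0) * P v).symm
  rw [two_mul]
  nth_rewrite 2 [h]
  rw [← Finset.sum_add_distrib]
  refine Finset.sum_le_sum fun v _ => ?_
  by_cases hv : v i = w i
  · have : flipAt i v i ≠ w i := by simp [flipAt, hv]
    simp [hv, this]
  · simp only [ne_eq, hv, not_false_eq_true, if_true, one_mul]
    exact (min_le_left _ _).trans le_self_add

/-- **Assouad's lemma** at a fixed observation: `P v` are the weights and `D v` the losses of one
decision against the vertices of the cube. -/
lemma sum_sum_min_flipAt_le {k : ℕ} {P D : (Fin k → Bool) → ℝ≥0∞} {C : ℝ≥0∞}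
    (hsep : ∀ v w, C * hammingDist v w ≤ D v + D w) :
    C * ∑ i, ∑ v, min (P v) (P (flipAt i v)) ≤ 4 * ∑ v, D v * P v := by
  -- The vertex of least loss acts as the decoded vertex: `D v + D w ≤ 2 * D v` for every `v`.
  obtain ⟨w, -, hw⟩ := Finset.exists_min_image Finset.univ D Finset.univ_nonempty
  calc C * ∑ i, ∑ v, min (P v) (P (flipAt i v))
      ≤ C * ∑ i, 2 * ∑ v, (if v i ≠ w i then 1 else 0) * P v := by
        gcongr with i
        exact sum_min_flipAt_le P w i
    _ = 2 * ∑ v, C * hammingDist v w * P v := by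
        simp_rw [← Finset.mul_sum]
        rw [Finset.sum_comm, mul_left_comm]
        simp_rw [mul_assoc, ← Finset.mul_sum, ← Finset.sum_mul]
        simp [hammingDist, Finset.card_filter]
    _ ≤ 2 * ∑ v, 2 * D v * P v := by
        refine mul_le_mul_right (Finset.sum_le_sum fun v _ => mul_le_mul_left ?_ _) _
        rw [two_mul]
        exact (hsep v w).trans (by gcongr; exact hw v (Finset.mem_univ v))
    _ = 4 * ∑ v, D v * P v := by
        simp_rw [mul_assoc, ← Finset.mul_sum]
        rw [← mul_assoc]
        norm_num

/-- **Assouad's lemma**, in terms of the overlaps of the densities at neighboring vertices. -/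
lemma assouad {Ω : Type*} [MeasurableSpace Ω] {ν : Measure Ω} {k : ℕ}
    {P D : (Fin k → Bool) → Ω → ℝ≥0∞} (hP : ∀ v, Measurable (P v)) (hD : ∀ v, Measurable (D v))
    {C δ : ℝ≥0∞} (hsep : ∀ ω v w, C * hammingDist v w ≤ D v ω + D w ω)
    (hδ : ∀ i v, δ ≤ ∫⁻ ω, min (P v ω) (P (flipAt i v) ω) ∂ν) :
    C * (k * (2 ^ k * δ)) ≤ 4 * ∑ v, ∫⁻ ω, D v ω * P v ω ∂ν := by
  calc C * (k * (2 ^ k * δ)) = C * ∑ _i : Fin k, ∑ _v : Fin k → Bool, δ := by simp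
    _ ≤ C * ∑ i, ∑ v, ∫⁻ ω, min (P v ω) (P (flipAt i v) ω) ∂ν := by
        gcongr with i _ v
        exact hδ i v
    _ = ∫⁻ ω, C * ∑ i, ∑ v, min (P v ω) (P (flipAt i v) ω) ∂ν := by
        rw [lintegral_const_mul _ (by fun_prop), lintegral_finsetSum _ (by fun_prop)]
        congr 2 with i
        rw [lintegral_finsetSum _ (by fun_prop)]
    _ ≤ ∫⁻ ω, 4 * ∑ v, D v ω * P v ω ∂ν :=
        lintegral_mono fun ω => sum_sum_min_flipAt_le (hsep ω)
    _ = _ := by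
        rw [lintegral_const_mul _ (by fun_prop), lintegral_finsetSum _ (by fun_prop)]

/-- The overlap of two product densities is bounded below through their Hellinger affinity. -/
lemma lintegral_min_prod_ge {α : Type*} [MeasurableSpace α] {ν : Measure α} [SigmaFinite ν]
    {n : ℕ} {p q : α → ℝ} (hp : ∀ x, 0 ≤ p x) (hq : ∀ x, 0 ≤ q x) (ip : Integrable p ν)
    (iq : Integrable q ν) (p1 : ∫ x, p x ∂ν = 1) (q1 : ∫ x, q x ∂ν = 1) {ε : ℝ} (hε : ε ≤ 1)
    (haff : 1 - ε ≤ ∫ x, √(p x * q x) ∂ν) :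
    ENNReal.ofReal (1 / 2 - n * ε) ≤ ∫⁻ X : Fin n → α,
      min (ENNReal.ofReal (∏ i, p (X i))) (ENNReal.ofReal (∏ i, q (X i)))
        ∂(Measure.pi fun _ => ν) := by
  have ia : Integrable (fun x => √(p x * q x)) ν := by
    refine (ip.add iq).mono' ?_ (Filter.Eventually.of_forall fun x => ?_)
    · exact (Real.continuous_sqrt.measurable.comp_aemeasurable
        (ip.aemeasurable.mul iq.aemeasurable)).aestronglyMeasurable
    · have := hp x
      have := hq x
      rw [Real.norm_of_nonneg (Real.sqrt_nonneg _), Pi.add_apply, Real.sqrt_le_left (by positivity)]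
      nlinarith
  have Ip : Integrable (fun X : Fin n → α => ∏ i, p (X i)) (Measure.pi fun _ => ν) :=
    Integrable.fintype_prod fun _ => ip
  have Iq : Integrable (fun X : Fin n → α => ∏ i, q (X i)) (Measure.pi fun _ => ν) :=
    Integrable.fintype_prod fun _ => iq
  have Ia : Integrable (fun X : Fin n → α => ∏ i, √(p (X i) * q (X i))) (Measure.pi fun _ => ν) :=
    Integrable.fintype_prod (f := fun _ x => √(p x * q x)) fun _ => ia
  have Im : Integrable (fun X : Fin n → α => min (∏ i, p (X i)) (∏ i, q (X i)))
      (Measure.pi fun _ => ν) := Ip.inf Iq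
  simp_rw [← ENNReal.ofReal_min]
  rw [← ofReal_integral_eq_lintegral_ofReal Im (Filter.Eventually.of_forall fun X => le_min
    (Finset.prod_nonneg fun _ _ => hp _) (Finset.prod_nonneg fun _ _ => hq _))]
  refine ENNReal.ofReal_le_ofReal ?_
  -- With `P` and `Q` the two products, `(√P - √Q / 2)² ≥ 0` gives `√(P Q) ≤ P + Q / 4`, and
  -- symmetrically. After integration, Bernoulli's inequality bounds the `n`-th power of the
  -- affinity.
  have hle : ∀ X : Fin n → α, ∏ i, √(p (X i) * q (X i)) -
      (1 / 4) * (∏ i, p (X i) + ∏ i, q (X i)) ≤ min (∏ i, p (X i)) (∏ i, q (X i)) := by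
    intro X
    have a0 : 0 ≤ ∏ i, p (X i) := Finset.prod_nonneg fun _ _ => hp _
    have b0 : 0 ≤ ∏ i, q (X i) := Finset.prod_nonneg fun _ _ => hq _
    rw [← Real.sqrt_prod _ fun i _ => mul_nonneg (hp _) (hq _), Finset.prod_mul_distrib,
      Real.sqrt_mul a0]
    have h1 := Real.sq_sqrt a0
    have h2 := Real.sq_sqrt b0
    refine le_min ?_ ?_
    · nlinarith [sq_nonneg (√(∏ i, p (X i)) - √(∏ i, q (X i)) / 2)]
    · nlinarith [sq_nonneg (√(∏ i, q (X i)) - √(∏ i, p (X i)) / 2)]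
  refine le_trans ?_ (integral_mono (Ia.sub ((Ip.add Iq).const_mul (1 / 4))) Im hle)
  have s1 := integral_sub Ia ((Ip.add Iq).const_mul (1 / 4))
  have s2 := integral_add Ip Iq
  simp only [Pi.add_apply, Pi.sub_apply] at s1 s2 ⊢
  rw [s1, integral_const_mul, s2, integral_fintype_prod_eq_pow (ι := Fin n) p,
    integral_fintype_prod_eq_pow (ι := Fin n) q,
    integral_fintype_prod_eq_pow (ι := Fin n) (fun x => √(p x * q x)), p1, q1, Fintype.card_fin]
  have b := one_add_mul_le_pow (show -2 ≤ -ε by linarith) n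
  have c := pow_le_pow_left₀ (show 0 ≤ 1 - ε by linarith) haff n
  rw [← sub_eq_add_neg] at b
  norm_num
  linarith

/-! ### The cube of means. -/

/-- The mean, of length `h`, attached to a vertex of the cube: it makes an angle with sine `s` with
the first axis, the vertex determining the signs of the other coordinates. -/
noncomputable def cubeMean {k : ℕ} (h s : ℝ) (v : Fin k → Bool) :
    EuclideanSpace ℝ (Fin (k + 1)) :=
  WithLp.toLp 2 (Fin.cons (h * √(1 - s ^ 2)) fun i => h * s / √k * if v i then 1 else -1)

lemma inner_cubeMean {k : ℕ} (hk : 0 < k) {h s : ℝ} (hs0 : 0 ≤ s) (hs1 : s ≤ 1)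
    (v w : Fin k → Bool) :
    inner ℝ (cubeMean h s v) (cubeMean h s w) =
      h ^ 2 * (1 - 2 * s ^ 2 * (hammingDist v w / k)) := by
  have hk' : (0 : ℝ) < k := by exact_mod_cast hk
  have h1 : √(1 - s ^ 2) * √(1 - s ^ 2) = 1 - s ^ 2 := Real.mul_self_sqrt (by nlinarith)
  have h2 : √(k : ℝ) ^ 2 = k := Real.sq_sqrt hk'.le
  have h3 : ∀ i, (h * s / √k * if v i then (1 : ℝ) else -1) *
      (h * s / √k * if w i then (1 : ℝ) else -1) =
      h ^ 2 * s ^ 2 / k * (1 - 2 * if v i ≠ w i then 1 else 0) := by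
    intro i
    have : h ^ 2 * s ^ 2 / k = (h * s / √k) * (h * s / √k) := by
      rw [div_mul_div_comm, ← sq √(k : ℝ), h2]
      ring
    rw [this]
    cases v i <;> cases w i <;> simp <;> ring
  have h4 : ((hammingDist v w : ℕ) : ℝ) = ∑ i, if v i ≠ w i then (1 : ℝ) else 0 := by
    rw [hammingDist, Finset.card_filter]
    push_cast
    rfl
  rw [real_inner_comm, PiLp.inner_apply, Fin.sum_univ_succ]
  simp only [cubeMean, Fin.cons_zero, Fin.cons_succ, RCLike.inner_apply, conj_trivial]
  simp_rw [h3]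
  rw [← Finset.mul_sum, Finset.sum_sub_distrib, ← Finset.mul_sum, ← h4, Finset.sum_const,
    Finset.card_univ, Fintype.card_fin, nsmul_eq_mul, mul_one]
  have : h * √(1 - s ^ 2) * (h * √(1 - s ^ 2)) = h ^ 2 * (1 - s ^ 2) := by
    linear_combination h ^ 2 * h1
  rw [this]
  field_simp
  ring

lemma norm_cubeMean {k : ℕ} (hk : 0 < k) {h s : ℝ} (hh : 0 ≤ h) (hs0 : 0 ≤ s) (hs1 : s ≤ 1)
    (v : Fin k → Bool) : ‖cubeMean h s v‖ = h := by
  have := inner_cubeMean (h := h) hk hs0 hs1 v v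
  rw [real_inner_self_eq_norm_sq, hammingDist_self] at this
  refine (sq_eq_sq₀ (norm_nonneg _) hh).1 (this.trans ?_)
  simp

/-- With `t` the normalized Hamming distance, the squared distance is `4 h² s² t`. Since `t ≤ 1`,
replacing `t` by `t²` gives a bound linear in the Hamming distance, as Assouad's lemma needs. -/
lemma norm_cubeMean_sub_ge {k : ℕ} (hk : 0 < k) {h s : ℝ} (hh : 0 ≤ h) (hs0 : 0 ≤ s) (hs1 : s ≤ 1)
    (v w : Fin k → Bool) :
    2 * h * s * (hammingDist v w / k) ≤ ‖cubeMean h s v - cubeMean h s w‖ := by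
  have hk' : (0 : ℝ) < k := by exact_mod_cast hk
  refine le_of_sq_le_sq ?_ (norm_nonneg _)
  rw [norm_sub_sq_real, inner_cubeMean hk hs0 hs1, norm_cubeMean hk hh hs0 hs1,
    norm_cubeMean hk hh hs0 hs1]
  obtain ⟨t, ht⟩ : ∃ t : ℝ, t = hammingDist v w / k := ⟨_, rfl⟩
  have h0 : 0 ≤ t := by rw [ht]; positivity
  have h1 : t ≤ 1 := by
    rw [ht, div_le_one hk']
    exact_mod_cast hammingDist_le_card_fintype.trans_eq (Fintype.card_fin k)
  rw [← ht]
  nlinarith [mul_nonneg (sq_nonneg (h * s)) (mul_nonneg h0 (sub_nonneg.2 h1))]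

/-! ### Clustering losses measured by the centered Gaussian. -/

lemma measurable_bayesAssign (θ : EuclideanSpace ℝ (Fin d) × EuclideanSpace ℝ (Fin d)) :
    Measurable (bayesAssign σ θ) := by
  unfold bayesAssign
  exact Measurable.ite (measurableSet_le (continuous_gaussDensity _).measurable
    (continuous_gaussDensity _).measurable) measurable_const measurable_const

/-- The clustering loss of `F` with respect to `θ = (m, -m)`, measured by `N(0, σ² I)`. -/
noncomputable def gaussLoss (σ : ℝ) (m : EuclideanSpace ℝ (Fin d))
    (F : EuclideanSpace ℝ (Fin d) → Fin 2) : ℝ≥0∞ :=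
  ⨅ π : Equiv.Perm (Fin 2), centeredGauss d σ {x | bayesAssign σ (m, -m) x ≠ π (F x)}

lemma gaussLoss_mul_le_clusterLoss (hσ : 0 < σ) (m : EuclideanSpace ℝ (Fin d))
    (F : EuclideanSpace ℝ (Fin d) → Fin 2) :
    ENNReal.ofReal (Real.exp (-(‖m‖ ^ 2 / (2 * σ ^ 2)))) * gaussLoss σ m F ≤
      clusterLoss σ (m, -m) F := by
  have hle : ENNReal.ofReal (Real.exp (-(‖m‖ ^ 2 / (2 * σ ^ 2)))) • centeredGauss d σ ≤
      mixMeasure σ (m, -m) := by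
    rw [centeredGauss, ← withDensity_smul _
      (continuous_gaussDensity 0).measurable.ennreal_ofReal]
    refine withDensity_mono (Filter.Eventually.of_forall fun x => ?_)
    rw [Pi.smul_apply, smul_eq_mul, ← ENNReal.ofReal_mul (Real.exp_pos _).le]
    exact ENNReal.ofReal_le_ofReal (symMix_ge hσ m x)
  refine le_iInf fun π => le_trans ?_ (hle _)
  rw [Measure.smul_apply, smul_eq_mul]
  exact mul_le_mul_right (iInf_le _ π) _

/-- Triangle inequality: if `π` and `π'` are the optimal relabelings of `F`, the two Bayes
assignments differ by `π * π'⁻¹` only where one of them disagrees with its relabeling of `F`. -/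
lemma gaussLoss_add_ge (hσ : 0 < σ) {h : ℝ} (hh : 0 < h) {m m' : EuclideanSpace ℝ (Fin d)}
    (hm : ‖m‖ = h) (hm' : ‖m'‖ = h) (hin : 0 ≤ inner ℝ m m')
    (F : EuclideanSpace ℝ (Fin d) → Fin 2) :
    ENNReal.ofReal (‖m - m'‖ / (2 * h) / 40) ≤ gaussLoss σ m F + gaussLoss σ m' F := by
  obtain ⟨π, hπ⟩ := exists_eq_ciInf_of_finite (f := fun π : Equiv.Perm (Fin 2) =>
    centeredGauss d σ {x | bayesAssign σ (m, -m) x ≠ π (F x)})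
  obtain ⟨π', hπ'⟩ := exists_eq_ciInf_of_finite (f := fun π : Equiv.Perm (Fin 2) =>
    centeredGauss d σ {x | bayesAssign σ (m', -m') x ≠ π (F x)})
  rw [gaussLoss, gaussLoss, ← hπ, ← hπ']
  refine (centeredGauss_bayesAssign_ne_ge hσ hh hm hm' hin (π * π'⁻¹)).trans
    ((measure_mono fun x hx => ?_).trans (measure_union_le _ _))
  by_contra hcon
  simp only [Set.mem_union, Set.mem_ofPred_eq, not_or, not_not] at hcon hx
  exact hx (by simp [hcon.1, hcon.2])

lemma measurable_gaussLoss_assign {n : ℕ} (m : EuclideanSpace ℝ (Fin d)) (Fhat : Estimator d n) :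
    Measurable fun X => gaussLoss σ m (Fhat.assign X) := by
  refine Measurable.iInf fun π => ?_
  refine measurable_measure_prodMk_left (ν := centeredGauss d σ)
    (s := {p | bayesAssign σ (m, -m) p.2 ≠ π (Fhat.assign p.1 p.2)}) ?_
  exact (measurableSet_eq_fun ((measurable_bayesAssign _).comp measurable_snd)
    ((measurable_of_countable π).comp Fhat.measurable_assign)).compl

lemma measurable_prod_symMix {n : ℕ} (m : EuclideanSpace ℝ (Fin d)) :
    Measurable fun X : Fin n → EuclideanSpace ℝ (Fin d) =>
      ENNReal.ofReal (∏ i, symMix σ m (X i)) :=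
  ENNReal.measurable_ofReal.comp
    (Continuous.measurable (f := fun X : Fin n → EuclideanSpace ℝ (Fin d) =>
      ∏ i, symMix σ m (X i)) (by fun_prop))

lemma lintegral_gaussLoss_le_expectedLoss (hσ : 0 < σ) {n : ℕ} (m : EuclideanSpace ℝ (Fin d))
    (Fhat : Estimator d n) :
    ENNReal.ofReal (Real.exp (-(‖m‖ ^ 2 / (2 * σ ^ 2)))) *
        ∫⁻ X : Fin n → EuclideanSpace ℝ (Fin d), gaussLoss σ m (Fhat.assign X) *
          ENNReal.ofReal (∏ i, symMix σ m (X i)) ≤ expectedLoss σ (m, -m) Fhat := by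
  have hpi : (Measure.pi fun _ : Fin n => mixMeasure σ (m, -m)) =
      (volume : Measure (Fin n → EuclideanSpace ℝ (Fin d))).withDensity
        fun X => ENNReal.ofReal (∏ i, symMix σ m (X i)) :=
    pi_withDensity_ofReal (fun _ x => (symMix_pos hσ m x).le) fun _ => integrable_symMix hσ m
  have hD := measurable_gaussLoss_assign (σ := σ) m Fhat
  have hP := measurable_prod_symMix (σ := σ) (n := n) m
  have hc := lintegral_const_mul (μ := volume)
    (ENNReal.ofReal (Real.exp (-(‖m‖ ^ 2 / (2 * σ ^ 2))))) (hD.mul hP)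
  simp only [Pi.mul_apply] at hc
  rw [expectedLoss, hpi, ← hc]
  refine le_trans (le_of_eq ?_) (lintegral_mono fun X => gaussLoss_mul_le_clusterLoss hσ m _)
  rw [lintegral_withDensity_eq_lintegral_mul _ hP (hD.const_mul _)]
  refine lintegral_congr fun X => ?_
  rw [Pi.mul_apply]
  ring

/-! ### Assembling the minimax bound. -/

/-- The difference factors through `1 - exp (-(a - b))` and `1 - exp (-(a + b))`, each bounded by `1
- exp (-t) ≤ t`. The extra factor `a` makes the affinity loss quadratic in `y`. -/
lemma cosh_sub_cosh_le {a b : ℝ} (hba : b ≤ a) (hb : 0 ≤ b) :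
    Real.cosh a - Real.cosh b ≤ Real.exp a * ((a - b) * a) := by
  have e1 : Real.cosh a - Real.cosh b =
      Real.exp a * ((1 - Real.exp (-(a - b))) * (1 - Real.exp (-(a + b))) / 2) := by
    rw [Real.cosh_eq, Real.cosh_eq, neg_sub, neg_add, Real.exp_add, Real.exp_sub, Real.exp_neg,
      Real.exp_neg]
    have := Real.exp_pos a
    have := Real.exp_pos b
    field_simp
    ring
  rw [e1]
  have h1 := Real.one_sub_le_exp_neg (a - b)
  have h2 := Real.one_sub_le_exp_neg (a + b)
  have h3 : 0 ≤ 1 - Real.exp (-(a + b)) := by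
    rw [sub_nonneg, Real.exp_le_one_iff]
    linarith
  have h4 : (1 - Real.exp (-(a - b))) * (1 - Real.exp (-(a + b))) ≤ (a - b) * (2 * a) :=
    mul_le_mul (by linarith) (by linarith) h3 (by linarith)
  refine mul_le_mul_of_nonneg_left ?_ (Real.exp_pos _).le
  linarith

/-- The lower bound of the minimax loss in terms of the angle `arcsin s` of the cube of means. -/
lemma minimaxLoss_ge {k n : ℕ} (hk : 0 < k) (hn : 1 ≤ n) (hσ : 0 < σ) {h s : ℝ} (hh : 0 < h)
    (hs0 : 0 ≤ s) (hs : s ≤ 1 / 2) {y : ℝ} (hy : y = h ^ 2 / σ ^ 2) (hy1 : y ≤ 1 / 100)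
    (hns : n * (y ^ 2 * s ^ 2) ≤ k / 4) :
    ENNReal.ofReal (Real.exp (-(y / 2)) * (s / 640)) ≤
      minimaxLoss (k + 1) n σ (2 * h) := by
  have hk' : (0 : ℝ) < k := by exact_mod_cast hk
  have hn' : (1 : ℝ) ≤ n := by exact_mod_cast hn
  have hs1 : s ≤ 1 := by linarith
  have hy0 : 0 ≤ y := by rw [hy]; positivity
  have hnorm := fun v : Fin k → Bool => norm_cubeMean (h := h) hk hh.le hs0 hs1 v
  have hhy : h ^ 2 / (2 * σ ^ 2) = y / 2 := by rw [hy]; field_simp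
  refine le_iInf fun Fhat => ?_
  set M := ⨆ θ ∈ meanPairs (k + 1) (2 * h), expectedLoss σ θ Fhat
  have hθ : ∀ v : Fin k → Bool, expectedLoss σ (cubeMean h s v, -cubeMean h s v) Fhat ≤ M := by
    intro v
    refine le_iSup₂_of_le (cubeMean h s v, -cubeMean h s v) ?_ le_rfl
    change 2 * h ≤ ‖cubeMean h s v - -cubeMean h s v‖
    rw [sub_neg_eq_add, ← two_smul ℝ, norm_smul, hnorm]
    norm_num
  have hoverlap : ∀ i (v : Fin k → Bool), ENNReal.ofReal (1 / 4) ≤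
      ∫⁻ X : Fin n → EuclideanSpace ℝ (Fin (k + 1)),
        min (ENNReal.ofReal (∏ j, symMix σ (cubeMean h s v) (X j)))
          (ENNReal.ofReal (∏ j, symMix σ (cubeMean h s (flipAt i v)) (X j))) := by
    intro i v
    have haff := affinity_symMix_ge hσ ((hnorm v).trans (hnorm (flipAt i v)).symm)
    rw [hnorm, inner_cubeMean hk hs0 hs1, hammingDist_flipAt, hhy, mul_div_right_comm, ← hy] at haff
    set ε := Real.exp (y / 2) / 4 *
      (Real.cosh y - Real.cosh (y * (1 - 2 * s ^ 2 * ((1 : ℕ) / k)))) with hε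
    have hk1 : (1 : ℝ) / k ≤ 1 := by
      rw [div_le_one hk']
      exact_mod_cast hk
    have hk0 : (0 : ℝ) ≤ 1 / k := by positivity
    have hc := cosh_sub_cosh_le (a := y) (b := y * (1 - 2 * s ^ 2 * ((1 : ℕ) / k)))
      (by
        rw [Nat.cast_one]
        nlinarith [mul_nonneg hy0 (mul_nonneg (sq_nonneg s) hk0)])
      (by
        rw [Nat.cast_one]
        refine mul_nonneg hy0 ?_
        nlinarith [mul_nonneg (sq_nonneg s) (sub_nonneg.2 hk1)])
    have hexp : Real.exp (y / 2) * Real.exp y ≤ 2 := by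
      rw [← Real.exp_add]
      refine (Real.exp_le_exp.2 ?_).trans_eq (Real.exp_log zero_lt_two)
      linarith [Real.log_two_gt_d9]
    -- One flip changes the argument of `cosh` by `2 y s² / k`, so `ε` is at most `exp (3y/2) y² s²
    -- / (2k)`.
    have hε1 : n * ε ≤ 1 / 4 := by
      calc n * ε ≤ n * (Real.exp (y / 2) / 4 *
            (Real.exp y * ((y - y * (1 - 2 * s ^ 2 * ((1 : ℕ) / k))) * y))) := by
            rw [hε]
            gcongr
        _ = Real.exp (y / 2) * Real.exp y * (n * (y ^ 2 * s ^ 2)) / (2 * k) := by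
            push_cast
            field_simp
            ring
        _ ≤ 2 * (k / 4) / (2 * k) := by gcongr
        _ = 1 / 4 := by
            field_simp
    have hε2 : ε ≤ 1 := by
      by_contra! hcon
      nlinarith
    refine (ENNReal.ofReal_le_ofReal ?_).trans (lintegral_min_prod_ge
      (fun x => (symMix_pos hσ (cubeMean h s v) x).le)
      (fun x => (symMix_pos hσ (cubeMean h s (flipAt i v)) x).le) (integrable_symMix hσ _)
      (integrable_symMix hσ _) (integral_symMix hσ _) (integral_symMix hσ _) hε2 haff)
    linarith
  have hsep : ∀ (X : Fin n → EuclideanSpace ℝ (Fin (k + 1))) (v w : Fin k → Bool),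
      ENNReal.ofReal (s / (40 * k)) * hammingDist v w ≤
        gaussLoss σ (cubeMean h s v) (Fhat.assign X) +
          gaussLoss σ (cubeMean h s w) (Fhat.assign X) := by
    intro X v w
    have hin : 0 ≤ inner ℝ (cubeMean h s v) (cubeMean h s w) := by
      rw [inner_cubeMean hk hs0 hs1]
      have h1 : (hammingDist v w / k : ℝ) ≤ 1 := by
        rw [div_le_one hk']
        exact_mod_cast hammingDist_le_card_fintype.trans_eq (Fintype.card_fin k)
      have h2 : (0 : ℝ) ≤ hammingDist v w / k := by positivity
      refine mul_nonneg (sq_nonneg h) ?_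
      nlinarith [mul_le_mul_of_nonneg_left h1 (sq_nonneg s)]
    refine le_trans ?_ (gaussLoss_add_ge hσ hh (hnorm v) (hnorm w) hin _)
    rw [← ENNReal.ofReal_natCast, ← ENNReal.ofReal_mul (by positivity)]
    refine ENNReal.ofReal_le_ofReal ?_
    have := norm_cubeMean_sub_ge hk hh.le hs0 hs1 v w
    rw [div_div, le_div_iff₀ (by positivity)]
    refine le_trans (le_of_eq ?_) this
    field_simp
  have hassouad := assouad
    (ν := (volume : Measure (Fin n → EuclideanSpace ℝ (Fin (k + 1)))))
    (P := fun v X => ENNReal.ofReal (∏ j, symMix σ (cubeMean h s v) (X j)))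
    (D := fun v X => gaussLoss σ (cubeMean h s v) (Fhat.assign X))
    (fun v => measurable_prod_symMix _)
    (fun v => measurable_gaussLoss_assign _ Fhat) hsep hoverlap
  have hsum : ENNReal.ofReal (Real.exp (-(y / 2))) * ∑ v : Fin k → Bool,
      ∫⁻ X : Fin n → EuclideanSpace ℝ (Fin (k + 1)),
        gaussLoss σ (cubeMean h s v) (Fhat.assign X) *
          ENNReal.ofReal (∏ j, symMix σ (cubeMean h s v) (X j)) ≤ 2 ^ k * M := by
    rw [Finset.mul_sum]
    calc _ ≤ ∑ _v : Fin k → Bool, M := Finset.sum_le_sum fun v _ => by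
          have := lintegral_gaussLoss_le_expectedLoss hσ (cubeMean h s v) Fhat
          rw [hnorm, hhy] at this
          exact this.trans (hθ v)
      _ = _ := by simp
  -- The constant is `640 = 40 * 4 * 4`: strip mass, overlap `1 / 4`, and the factor `4` in
  -- `assouad`.
  have hfin : ENNReal.ofReal (Real.exp (-(y / 2)) * (s / 640)) * (4 * 2 ^ k) ≤ M * (4 * 2 ^ k) := by
    calc ENNReal.ofReal (Real.exp (-(y / 2)) * (s / 640)) * (4 * 2 ^ k)
        = ENNReal.ofReal (Real.exp (-(y / 2))) *
          (ENNReal.ofReal (s / (40 * k)) * (k * (2 ^ k * ENNReal.ofReal (1 / 4)))) := by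
          have e4 : (4 : ℝ≥0∞) = ENNReal.ofReal 4 := by norm_num
          have e2 : (2 : ℝ≥0∞) ^ k = ENNReal.ofReal (2 ^ k) := by
            rw [ENNReal.ofReal_pow (by norm_num)]
            norm_num
          rw [e4, e2, ← ENNReal.ofReal_natCast k]
          simp (disch := positivity) only [← ENNReal.ofReal_mul]
          congr 1
          field_simp
          ring
      _ ≤ ENNReal.ofReal (Real.exp (-(y / 2))) * (4 * _) := mul_le_mul_right hassouad _
      _ ≤ 4 * (2 ^ k * M) := by
          rw [mul_left_comm]
          exact mul_le_mul_right hsum _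
      _ = _ := by ring
  exact (ENNReal.mul_le_mul_iff_left (by simp) (by finiteness)).1 hfin

end GaussianClustering

/-! ### Choice of the angle and numerical constants. -/

/-- The minimax lower bound, and the number of samples that it makes necessary for any target
value `r < 1/2000` of the minimax loss. -/
theorem theorem2 (d n : ℕ) (σ lam : ℝ) (hd : 9 ≤ d) (hn : 1 ≤ n) (hσ : 0 < σ) (hlam : 0 < lam)
    (hsnr : lam / σ ≤ 0.2) :
    ENNReal.ofReal (1 / 500 *
        min (√(Real.log 2) / 3 * (σ ^ 2 / lam ^ 2) * √(((d : ℝ) - 1) / n)) (1 / 4))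
      ≤ GaussianClustering.minimaxLoss d n σ lam ∧
    ∀ r : ℝ, 0 < r → r < 1 / 2000 →
      GaussianClustering.minimaxLoss d n σ lam ≤ ENNReal.ofReal r →
      Real.log 2 / (9 * (500 * r) ^ 2) * (((d : ℝ) - 1) * (σ ^ 4 / lam ^ 4)) ≤ n := by
  have hn' : (0 : ℝ) < n := by exact_mod_cast hn
  have hlog0 : 0 ≤ Real.log 2 := Real.log_nonneg (by norm_num)
  obtain ⟨k, rfl⟩ : ∃ k, d = k + 1 := ⟨d - 1, by omega⟩
  have hk : 0 < k := by omega
  have hk' : (0 : ℝ) < k := by exact_mod_cast hk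
  have hcast : ((k + 1 : ℕ) : ℝ) - 1 = k := by push_cast; ring
  rw [hcast]
  have main : ENNReal.ofReal (1 / 500 *
      min (√(Real.log 2) / 3 * (σ ^ 2 / lam ^ 2) * √((k : ℝ) / n)) (1 / 4))
      ≤ GaussianClustering.minimaxLoss (k + 1) n σ lam := by
    obtain ⟨y, hy⟩ : ∃ y, y = (lam / 2) ^ 2 / σ ^ 2 := ⟨_, rfl⟩
    have hy0 : 0 < y := by rw [hy]; positivity
    have hy1 : y ≤ 1 / 100 := by
      have h1 : 0 ≤ lam / σ := by positivity
      have h2 : y = (lam / σ) ^ 2 / 4 := by rw [hy]; ring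
      rw [h2]
      nlinarith
    obtain ⟨T, hT⟩ : ∃ T, T = √((k : ℝ) / n) / y := ⟨_, rfl⟩
    have hT0 : 0 ≤ T := by rw [hT]; positivity
    have hT2 : n * (y ^ 2 * T ^ 2) = k := by
      rw [hT, div_pow, Real.sq_sqrt (by positivity)]
      field_simp
    -- `T` solves `n y² T² = k`, so half of it meets the overlap condition; the cap at `1` keeps `s
    -- ≤ 1 / 2`.
    obtain ⟨s, hs⟩ : ∃ s, s = min T 1 / 2 := ⟨_, rfl⟩
    have hs0 : 0 ≤ s := by rw [hs]; positivity
    have hsT : s ≤ T / 2 := by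
      rw [hs]
      linarith [min_le_left T 1]
    have hs1 : s ≤ 1 / 2 := by
      rw [hs]
      linarith [min_le_right T 1]
    have hns : n * (y ^ 2 * s ^ 2) ≤ k / 4 := by
      calc n * (y ^ 2 * s ^ 2) ≤ n * (y ^ 2 * (T / 2) ^ 2) := by gcongr
        _ = n * (y ^ 2 * T ^ 2) / 4 := by ring
        _ = k / 4 := by rw [hT2]
    have hmin := GaussianClustering.minimaxLoss_ge hk hn hσ (half_pos hlam) hs0 hs1 hy hy1 hns
    rw [mul_div_cancel₀ lam two_ne_zero] at hmin
    refine (ENNReal.ofReal_le_ofReal ?_).trans hmin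
    have hexp : 9 / 10 ≤ Real.exp (-(y / 2)) := by
      linarith [Real.one_sub_le_exp_neg (y / 2)]
    have hsqrt : √(Real.log 2) ≤ 1 := by
      rw [Real.sqrt_le_one]
      linarith [Real.log_two_lt_d9]
    -- Since `y = lam² / (4 σ²)`, the ratio `σ² / lam²` is `1 / (4 y)`.
    have hA : √(Real.log 2) / 3 * (σ ^ 2 / lam ^ 2) * √((k : ℝ) / n) ≤ T / 4 := by
      calc √(Real.log 2) / 3 * (σ ^ 2 / lam ^ 2) * √((k : ℝ) / n)
          = √(Real.log 2) / 12 * T := by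
            rw [hT, hy]
            field_simp
            norm_num
        _ ≤ 1 / 4 * T := by
            gcongr
            linarith
        _ = T / 4 := by ring
    calc 1 / 500 * min (√(Real.log 2) / 3 * (σ ^ 2 / lam ^ 2) * √((k : ℝ) / n)) (1 / 4)
        ≤ 1 / 500 * (s / 2) := by
          gcongr
          rw [hs]
          rcases le_total T 1 with h | h
          · rw [min_eq_left h]
            exact (min_le_left _ _).trans (hA.trans (by linarith))
          · rw [min_eq_right h]
            exact (min_le_right _ _).trans (by norm_num)
      _ ≤ 9 / 10 * (s / 640) := by linarith
      _ ≤ _ := by gcongr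
  refine ⟨main, fun r hr hr2 hle => ?_⟩
  have h1 := (ENNReal.ofReal_le_ofReal_iff hr.le).1 (main.trans hle)
  -- If the minimum were `1 / 4`, then `r ≥ 1 / 2000`.
  have h2 : √(Real.log 2) / 3 * (σ ^ 2 / lam ^ 2) * √((k : ℝ) / n) ≤ 500 * r := by
    rcases min_choice (√(Real.log 2) / 3 * (σ ^ 2 / lam ^ 2) * √((k : ℝ) / n)) (1 / 4)
      with h | h <;> rw [h] at h1 <;> linarith
  have h3 := pow_le_pow_left₀ (by positivity) h2 2
  rw [mul_pow, mul_pow, div_pow, div_pow, Real.sq_sqrt hlog0, Real.sq_sqrt (by positivity)] at h3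
  calc Real.log 2 / (9 * (500 * r) ^ 2) * (k * (σ ^ 4 / lam ^ 4))
      = n * (Real.log 2 / 3 ^ 2 * ((σ ^ 2) ^ 2 / (lam ^ 2) ^ 2) * (k / n)) / (500 * r) ^ 2 := by
        field_simp
        norm_num
    _ ≤ n * (500 * r) ^ 2 / (500 * r) ^ 2 := by gcongr
    _ = n := by field_simp
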